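/- A permutation $\pi=\pi_1\cdots\pi_n\in S_n$ contains the pattern $\sigma\in S_k$ if there are indices $i_1<\cdots<i_k$ such that $\pi_{i_1}\cdots\pi_{i_k}$ is order-isomorphic to $\sigma_1\cdots\sigma_k$; otherwise $\pi$ avoids $\sigma$. Let $e_n(\sigma)$ be the number of even permutations in $S_n$ that avoid $\sigma$. Patterns $\sigma,\tau$ are even-Wilf-equivalent if $e_n(\sigma)=e_n(\tau)$ for all $n\ge 0$. Write $\sigma^r=\sigma_k\cdots\sigma_1$ and $\sigma^c=(k+1-\sigma_1)\cdots(k+1-\sigma_k)$ for the reverse and the complement of $\sigma$, and $\sigma^{rc}=(\sigma^r)^c$. A set of patterns is called a trivial class if it has the form $\{\sigma,\sigma^{-1},\sigma^{rc},(\sigma^{-1})^{rc}\}$ for a pattern $\sigma$, and non-trivial otherwise. **Theorem.** The patterns of length 4 fall into exactly eleven even-Wilf-equivalence classes, namely $$\{3214,1432,2134,1243\},\ \{3421,4312,4123,2341\},\ \{2431,3241,4132,4213\},\ \{1342,1423,2314,3124\},$$ $$\{2413,3142\},\ \{1234\},\ \{4321\},\ \{2143\},\ \{3412\},\ \{1324\},\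 \{4231\}.$$ Exactly two of these classes are non-trivial, namely $\{3214,1432,2134,1243\}$ and $\{3421,4312,4123,2341\}$, and the second consists of the reverses of the elements of the first. Moreover, if $\sigma,\tau\in S_4$ are not even-Wilf-equivalent, then $e_n(\sigma)\neq e_n(\tau)$ for some $n\le 10$. -/

import Mathlib

namespace EvenWilf

/-- `π` contains the pattern `σ`: there are positions `i₁ < ⋯ < iₖ` at which the entries of `π`
are in the same relative order as the entries of `σ`. -/
def Contains {k n : ℕ} (σ : Equiv.Perm (Fin k)) (π : Equiv.Perm (Fin n)) : Prop :=
  ∃ f : Fin k → Fin n, StrictMono f ∧ ∀ i j : Fin k, π (f i) < π (f j) ↔ σ i < σ j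

/-- The set of even permutations of length `n` that avoid `σ`. -/
def evenAvoiders (n : ℕ) {k : ℕ} (σ : Equiv.Perm (Fin k)) : Set (Equiv.Perm (Fin n)) :=
  {π | Equiv.Perm.sign π = 1 ∧ ¬ Contains σ π}

/-- The number of even permutations of length `n` that avoid `σ`. -/
noncomputable def evenAv (n : ℕ) {k : ℕ} (σ : Equiv.Perm (Fin k)) : ℕ :=
  (evenAvoiders n σ).ncard

/-- Even-Wilf-equivalence of two patterns of length `k`. -/
def evenWilf (k : ℕ) : Setoid (Equiv.Perm (Fin k)) where
  r σ τ := ∀ n : ℕ, evenAv n σ = evenAv n τ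
  iseqv := ⟨fun _ _ => rfl, fun h n => (h n).symm, fun h₁ h₂ n => (h₁ n).trans (h₂ n)⟩

/-- The reverse `σₖ ⋯ σ₂ σ₁` of `σ = σ₁ σ₂ ⋯ σₖ`. -/
def reverse {k : ℕ} (σ : Equiv.Perm (Fin k)) : Equiv.Perm (Fin k) :=
  Fin.revPerm.trans σ

/-- The complement `(k + 1 - σ₁) ⋯ (k + 1 - σₖ)` of `σ = σ₁ ⋯ σₖ`. -/
def complement {k : ℕ} (σ : Equiv.Perm (Fin k)) : Equiv.Perm (Fin k) :=
  σ.trans Fin.revPerm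

/-- The trivial class of `σ`: the patterns obtained from `σ` by inversion, by reverse-complement,
and by both. -/
def trivialClass {k : ℕ} (σ : Equiv.Perm (Fin k)) : Set (Equiv.Perm (Fin k)) :=
  {σ, σ⁻¹, complement (reverse σ), complement (reverse σ⁻¹)}

/-- A class of patterns is non-trivial if it is not the trivial class of one pattern. -/
def IsNontrivialClass {k : ℕ} (C : Set (Equiv.Perm (Fin k))) : Prop :=
  ¬ ∃ σ : Equiv.Perm (Fin k), C = trivialClass σ

/-- The one-line word of a pattern of length 4, entries `1, …, 4`, read as a decimal numeral. -/
def oneLine (σ : Equiv.Perm (Fin 4)) : ℕ :=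
  1000 * ((σ 0 : ℕ) + 1) + 100 * ((σ 1 : ℕ) + 1) + 10 * ((σ 2 : ℕ) + 1) + ((σ 3 : ℕ) + 1)

/-- The set of patterns of length 4 whose one-line words are in `W`. -/
def patterns (W : Set ℕ) : Set (Equiv.Perm (Fin 4)) :=
  {σ | oneLine σ ∈ W}

end EvenWilf

open EvenWilf

/-! Inversion and reverse-complement preserve both sign and containment, so each trivial class lies
inside one even-Wilf class. The only further coincidence needed is that 2134 and 3214 are avoided
equally often by permutations of each sign (`ncard_avoid_2134_eq_3214`). Sign +1 merges the two
trivial classes into the first non-trivial class. Reversal multiplies all signs in `S_n` by one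
constant, so having both signs also gives the second.

That equality is proved by interpolation. For a threshold `m`, `hybridPerms` allows 3214 only with
its 3 at least `m`, and 2134 only with its 3 below `m`. Threshold 0 means avoiding 2134, threshold
`n` means avoiding 3214. Passing from `r` to `r + 1` concerns only occurrences whose 3 is the value
`r`. Such a 321 and 213 are exchanged by rotating three entries, while a larger entry further right
stays put as the 4. A 3-cycle is even, so the sign survives. Choosing the triple canonically makes
the rotation invertible and keeps the constraints on other thresholds (`ncard_rotate`).

The eleven classes are then separated by counts at lengths 4, 6 and 7, computed by an enumeration
proved correct in `evenAv_eq_countEven`. -/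

namespace EvenWilf

/-! ### Rotating canonical triples with top value `r` -/

section Rotation

variable {n m : ℕ}

/-- The entries of `f` at the positions `i, j, k, l` form the pattern `3214`. -/
def Occ3214 (f : Fin n → Fin m) (i j k l : Fin n) : Prop :=
  i < j ∧ j < k ∧ k < l ∧ f k < f j ∧ f j < f i ∧ f i < f l

/-- The entries of `f` at the positions `i, j, k, l` form the pattern `2134`. -/
def Occ2134 (f : Fin n → Fin m) (i j k l : Fin n) : Prop :=
  i < j ∧ j < k ∧ k < l ∧ f j < f i ∧ f i < f k ∧ f k < f l

/-- Every `3` in a pattern `3214` is at least `r`, and every `3` in a pattern `2134` is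
at most `r`. -/
def Hybrid (f : Fin n → Fin m) (r : Fin m) : Prop :=
  (∀ i j k l, Occ3214 f i j k l → r ≤ f i) ∧ ∀ i j k l, Occ2134 f i j k l → f k ≤ r

/-- The entries at `a, b, c` form the `321` that is canonical among those with `f a = r` that
extend to a `3214`. -/
structure Canonical321 (f : Fin n → Fin m) (r : Fin m) (a b c : Fin n) : Prop where
  top : f a = r
  ab : a < b
  bc : b < c
  fcb : f c < f b
  fba : f b < r
  large : ∃ L, c < L ∧ r < f L
  first_b : ∀ b', a < b' → b' < b → f b' < r → ∀ c' l', b' < c' → c' < l' → r < f l' → f b' ≤ f c'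
  first_c : ∀ c', b < c' → c' < c → f b ≤ f c'

/-- The entries at `a, b, c` form the `213` that is canonical among those with `f c = r` that
extend to a `2134`. -/
structure Canonical213 (f : Fin n → Fin m) (r : Fin m) (a b c : Fin n) : Prop where
  top : f c = r
  ab : a < b
  bc : b < c
  fba : f b < f a
  fac : f a < r
  large : ∃ L, c < L ∧ r < f L
  last_b : ∀ b', b < b' → b' < c → f b' < r → ∀ a', a' < b' → f a' < r → f a' ≤ f b'
  last_a : ∀ a', a < a' → a' < b → f a' < r → f a' ≤ f b

variable {f g : Fin n → Fin m} {r : Fin m} {a b c : Fin n}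

/-- A forbidden occurrence in `g` yields one in `f` after trading the moved entries for suitable
ones among `a, b, c, L`. Where no trade works, the occurrence contradicts the choice of `b` or `c`
as the first possible position. -/
theorem Canonical321.hybrid (hf : Function.Injective f) (H : Hybrid f r)
    (h : Canonical321 f r a b c) (ga : g a = f b) (gb : g b = f c) (gc : g c = f a)
    (go : ∀ x, x ≠ a → x ≠ b → x ≠ c → g x = f x) : Hybrid g r := by
  obtain ⟨top, ab, bc, fcb, fba, ⟨L, cL, rL⟩, first_b, first_c⟩ := h
  have noJ : ∀ i j k l, i < j → j < k → k < l → f k < f j → f j < f i → f i < f l → f i < r →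
      False := fun i j k l h1 h2 h3 h4 h5 h6 h7 =>
    absurd (H.1 i j k l ⟨h1, h2, h3, h4, h5, h6⟩) (not_le.2 h7)
  have noF : ∀ i j k l, i < j → j < k → k < l → f j < f i → f i < f k → f k < f l → r < f k →
      False := fun i j k l h1 h2 h3 h4 h5 h6 h7 =>
    absurd (H.2 i j k l ⟨h1, h2, h3, h4, h5, h6⟩) (not_le.2 h7)
  have key : ∀ x, x = a ∧ g x = f b ∨ x = b ∧ g x = f c ∨ x = c ∧ g x = f a ∨
      x ≠ a ∧ x ≠ b ∧ x ≠ c ∧ g x = f x := by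
    intro x
    by_cases ha : x = a
    · exact .inl ⟨ha, ha ▸ ga⟩
    by_cases hb : x = b
    · exact .inr (.inl ⟨hb, hb ▸ gb⟩)
    by_cases hc : x = c
    · exact .inr (.inr (.inl ⟨hc, hc ▸ gc⟩))
    exact .inr (.inr (.inr ⟨ha, hb, hc, go x ha hb hc⟩))
  constructor
  · intro i j k l ⟨ij, jk, kl, kj, ji, il⟩
    by_contra! hlt
    -- Only the size of the 4 matters. If it sits on a moved position, `L` replaces it: `L` lies
    -- right of `c` and its value exceeds `r`, which exceeds `g i`.
    obtain ⟨l', kl', il'⟩ : ∃ l', k < l' ∧ g i < f l' := by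
      rcases key l with ⟨el, hl⟩ | ⟨el, hl⟩ | ⟨el, hl⟩ | ⟨la, lb, lc, hl⟩
      · exact ⟨L, by omega, by omega⟩
      · exact ⟨L, by omega, by omega⟩
      · exact ⟨L, by omega, by omega⟩
      · exact ⟨l, kl, by omega⟩
    clear il kl
    have key' : ∀ x, g x < r → x = a ∧ g x = f b ∨ x = b ∧ g x = f c ∨
        x ≠ a ∧ x ≠ b ∧ x ≠ c ∧ g x = f x := by
      intro x hx
      rcases key x with h | h | h | h
      exacts [.inl h, .inr (.inl h), by omega, .inr (.inr h)]
    have gj : g j < r := by omega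
    have gk : g k < r := by omega
    rcases key' i (by omega) with ⟨ei, hi⟩ | ⟨ei, hi⟩ | ⟨ia, ib, ic, hi⟩ <;>
      rcases key' j (by omega) with ⟨ej, hj⟩ | ⟨ej, hj⟩ | ⟨ja, jb, jc, hj⟩ <;>
      rcases key' k (by omega) with ⟨ek, hk⟩ | ⟨ek, hk⟩ | ⟨ka, kb, kc, hk⟩ <;>
      try omega
    · by_cases hc : k < c
      · have := first_c k (by omega) hc; omega
      · refine noJ b c k l' ?_ ?_ ?_ ?_ ?_ ?_ ?_ <;> omega
    · have := first_b j (by omega) (by omega) (by omega) c L (by omega) cL rL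
      omega
    · by_cases hc : j < b
      · have hjc := first_b j (by omega) hc (by omega) c L (by omega) cL rL
        by_cases hL : k < L
        · have := first_b j (by omega) hc (by omega) k L jk hL rL
          omega
        · refine noJ b c k l' ?_ ?_ ?_ ?_ ?_ ?_ ?_ <;> omega
      · refine noJ b j k l' ?_ ?_ ?_ ?_ ?_ ?_ ?_ <;> omega
    · by_cases hc : j < c
      · have := first_c j (by omega) hc; omega
      · refine noJ c j k l' ?_ ?_ ?_ ?_ ?_ ?_ ?_ <;> omega
    · refine noJ i b c L ?_ ?_ ?_ ?_ ?_ ?_ ?_ <;> omega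
    · refine noJ i b c L ?_ ?_ ?_ ?_ ?_ ?_ ?_ <;> omega
    · by_cases hc : k < c
      · have := first_c k (by omega) hc; omega
      · refine noJ i c k l' ?_ ?_ ?_ ?_ ?_ ?_ ?_ <;> omega
    · refine noJ i j b L ?_ ?_ ?_ ?_ ?_ ?_ ?_ <;> omega
    · refine noJ i j c L ?_ ?_ ?_ ?_ ?_ ?_ ?_ <;> omega
    · refine noJ i j k l' ?_ ?_ ?_ ?_ ?_ ?_ ?_ <;> omega
  · intro i j k l ⟨ij, jk, kl, ji, ik, kl'⟩
    by_contra! hlt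
    -- The rotation moves only values at most `r`, so the 3 and the 4, both above `r`, are unmoved.
    have hk : g k = f k := by
      rcases key k with h | h | h | h <;> omega
    have hl : g l = f l := by
      rcases key l with h | h | h | h <;> omega
    -- If `k` is right of `b`, then `a, b` already serve as the 21 in `f`. Otherwise only position
    -- `a` among the moved ones can take part.
    by_cases hbk : b < k
    · refine noF a b k l ?_ ?_ ?_ ?_ ?_ ?_ ?_ <;> omega
    rcases key i with ⟨ei, hi⟩ | ⟨ei, hi⟩ | ⟨ei, hi⟩ | ⟨ia, ib, ic, hi⟩
    · rcases key j with ⟨ej, hj⟩ | ⟨ej, hj⟩ | ⟨ej, hj⟩ | ⟨ja, jb, jc, hj⟩ <;> try omega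
      refine noF a j k l ?_ ?_ ?_ ?_ ?_ ?_ ?_ <;> omega
    · omega
    · omega
    · rcases key j with ⟨ej, hj⟩ | ⟨ej, hj⟩ | ⟨ej, hj⟩ | ⟨ja, jb, jc, hj⟩ <;> try omega
      · by_cases hir : f i < r
        · refine noJ i b c L ?_ ?_ ?_ ?_ ?_ ?_ ?_ <;> omega
        · have : f i ≠ f a := fun h => ia (hf h)
          refine noF i a k l ?_ ?_ ?_ ?_ ?_ ?_ ?_ <;> omega
      · refine noF i j k l ?_ ?_ ?_ ?_ ?_ ?_ ?_ <;> omega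

/-- The same trading of entries as for `Canonical321.hybrid`; here the choice of `b` and `a` as the
last possible positions excludes the remaining cases. -/
theorem Canonical213.hybrid (hf : Function.Injective f) (H : Hybrid f r)
    (h : Canonical213 f r a b c) (ga : g a = f c) (gb : g b = f a) (gc : g c = f b)
    (go : ∀ x, x ≠ a → x ≠ b → x ≠ c → g x = f x) : Hybrid g r := by
  obtain ⟨top, ab, bc, fba, fac, ⟨L, cL, rL⟩, last_b, last_a⟩ := h
  have noJ : ∀ i j k l, i < j → j < k → k < l → f k < f j → f j < f i → f i < f l → f i < r →
      False := fun i j k l h1 h2 h3 h4 h5 h6 h7 =>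
    absurd (H.1 i j k l ⟨h1, h2, h3, h4, h5, h6⟩) (not_le.2 h7)
  have noF : ∀ i j k l, i < j → j < k → k < l → f j < f i → f i < f k → f k < f l → r < f k →
      False := fun i j k l h1 h2 h3 h4 h5 h6 h7 =>
    absurd (H.2 i j k l ⟨h1, h2, h3, h4, h5, h6⟩) (not_le.2 h7)
  have key : ∀ x, x = a ∧ g x = f c ∨ x = b ∧ g x = f a ∨ x = c ∧ g x = f b ∨
      x ≠ a ∧ x ≠ b ∧ x ≠ c ∧ g x = f x := by
    intro x
    by_cases ha : x = a
    · exact .inl ⟨ha, ha ▸ ga⟩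
    by_cases hb : x = b
    · exact .inr (.inl ⟨hb, hb ▸ gb⟩)
    by_cases hc : x = c
    · exact .inr (.inr (.inl ⟨hc, hc ▸ gc⟩))
    exact .inr (.inr (.inr ⟨ha, hb, hc, go x ha hb hc⟩))
  constructor
  · intro i j k l ⟨ij, jk, kl, kj, ji, il⟩
    by_contra! hlt
    obtain ⟨l', kl', il'⟩ : ∃ l', k < l' ∧ g i < f l' := by
      rcases key l with ⟨el, hl⟩ | ⟨el, hl⟩ | ⟨el, hl⟩ | ⟨la, lb, lc, hl⟩
      · exact ⟨L, by omega, by omega⟩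
      · exact ⟨L, by omega, by omega⟩
      · exact ⟨L, by omega, by omega⟩
      · exact ⟨l, kl, by omega⟩
    clear il kl
    have key' : ∀ x, g x < r → x = b ∧ g x = f a ∨ x = c ∧ g x = f b ∨
        x ≠ a ∧ x ≠ b ∧ x ≠ c ∧ g x = f x := by
      intro x hx
      rcases key x with h | h | h | h
      exacts [by omega, .inl h, .inr (.inl h), .inr (.inr h)]
    have gj : g j < r := by omega
    have gk : g k < r := by omega
    rcases key' i (by omega) with ⟨ei, hi⟩ | ⟨ei, hi⟩ | ⟨ia, ib, ic, hi⟩ <;>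
      rcases key' j (by omega) with ⟨ej, hj⟩ | ⟨ej, hj⟩ | ⟨ja, jb, jc, hj⟩ <;>
      rcases key' k (by omega) with ⟨ek, hk⟩ | ⟨ek, hk⟩ | ⟨ka, kb, kc, hk⟩ <;>
      try omega
    · refine noJ a b k l' ?_ ?_ ?_ ?_ ?_ ?_ ?_ <;> omega
    · have := last_b j (by omega) (by omega) (by omega) a (by omega) fac
      omega
    · by_cases hc : j < c
      · have := last_b j (by omega) hc (by omega) a (by omega) fac; omega
      · refine noJ a j k l' ?_ ?_ ?_ ?_ ?_ ?_ ?_ <;> omega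
    · refine noJ b j k l' ?_ ?_ ?_ ?_ ?_ ?_ ?_ <;> omega
    · by_cases hc : i < a
      · refine noJ i a b L ?_ ?_ ?_ ?_ ?_ ?_ ?_ <;> omega
      · have := last_a i (by omega) (by omega) (by omega); omega
    · by_cases hc : i < a
      · refine noJ i a k l' ?_ ?_ ?_ ?_ ?_ ?_ ?_ <;> omega
      · have := last_a i (by omega) (by omega) (by omega); omega
    · by_cases hc : i < b
      · refine noJ i b k l' ?_ ?_ ?_ ?_ ?_ ?_ ?_ <;> omega
      · have := last_b i (by omega) (by omega) (by omega) a (by omega) fac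
        refine noJ a b k l' ?_ ?_ ?_ ?_ ?_ ?_ ?_ <;> omega
    · by_cases hc : j < a
      · refine noJ i j a L ?_ ?_ ?_ ?_ ?_ ?_ ?_ <;> omega
      · have := last_a j (by omega) (by omega) (by omega); omega
    · by_cases hc : j < b
      · refine noJ i j b L ?_ ?_ ?_ ?_ ?_ ?_ ?_ <;> omega
      · have := last_b j (by omega) (by omega) (by omega) i (by omega) (by omega); omega
    · refine noJ i j k l' ?_ ?_ ?_ ?_ ?_ ?_ ?_ <;> omega
  · intro i j k l ⟨ij, jk, kl, ji, ik, kl'⟩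
    by_contra! hlt
    have hk : g k = f k := by
      rcases key k with h | h | h | h <;> omega
    have hl : g l = f l := by
      rcases key l with h | h | h | h <;> omega
    by_cases hbk : b < k
    · refine noF a b k l ?_ ?_ ?_ ?_ ?_ ?_ ?_ <;> omega
    rcases key i with ⟨ei, hi⟩ | ⟨ei, hi⟩ | ⟨ei, hi⟩ | ⟨ia, ib, ic, hi⟩
    · rcases key j with ⟨ej, hj⟩ | ⟨ej, hj⟩ | ⟨ej, hj⟩ | ⟨ja, jb, jc, hj⟩ <;> try omega
      have := last_a j (by omega) (by omega) (by omega)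
      have : f j ≠ f b := fun h => jb (hf h)
      refine noF a j k l ?_ ?_ ?_ ?_ ?_ ?_ ?_ <;> omega
    · omega
    · omega
    · rcases key j with ⟨ej, hj⟩ | ⟨ej, hj⟩ | ⟨ej, hj⟩ | ⟨ja, jb, jc, hj⟩ <;> try omega
      · refine noF i a k l ?_ ?_ ?_ ?_ ?_ ?_ ?_ <;> omega
      · refine noF i j k l ?_ ?_ ?_ ?_ ?_ ?_ ?_ <;> omega

/-- That `c` came first makes `b` last, and that `b` came first makes `a` last. An older entry `a'`
violating the former would give a 3214 at `a', b', c, L` with its 3 below `r`, which `H` forbids. -/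
theorem Canonical321.canonical213 (H : Hybrid f r)
    (h : Canonical321 f r a b c) (ga : g a = f b) (gb : g b = f c) (gc : g c = f a)
    (go : ∀ x, x ≠ a → x ≠ b → x ≠ c → g x = f x) : Canonical213 g r a b c := by
  obtain ⟨top, ab, bc, fcb, fba, ⟨L, cL, rL⟩, first_b, first_c⟩ := h
  refine ⟨by omega, ab, bc, by omega, by omega,
    ⟨L, cL, by rw [go L (by omega) (by omega) (by omega)]; exact rL⟩, ?_, ?_⟩
  · intro b' hb1 hb2 hb3 a' ha hr
    have e := go b' (by omega) (by omega) (by omega)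
    have := first_c b' hb1 hb2
    by_cases h1 : a' = a
    · rw [h1]; omega
    by_cases h2 : a' = b
    · rw [h2]; omega
    have e' := go a' h1 h2 (by omega)
    by_contra! hlt
    have gL : g L = f L := go L (by omega) (by omega) (by omega)
    have := H.1 a' b' c L ⟨ha, hb2, cL, by omega, by omega, by omega⟩
    omega
  · intro a' h1 h2 h3
    have e := go a' (by omega) (by omega) (by omega)
    have := first_b a' h1 h2 (by omega) c L (by omega) cL rL
    omega

theorem Canonical213.canonical321 (hf : Function.Injective f) (H : Hybrid f r)
    (h : Canonical213 f r a b c) (ga : g a = f c) (gb : g b = f a) (gc : g c = f b)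
    (go : ∀ x, x ≠ a → x ≠ b → x ≠ c → g x = f x) : Canonical321 g r a b c := by
  obtain ⟨top, ab, bc, fba, fac, ⟨L, cL, rL⟩, last_b, last_a⟩ := h
  refine ⟨by omega, ab, bc, by omega, by omega,
    ⟨L, cL, by rw [go L (by omega) (by omega) (by omega)]; exact rL⟩, ?_, ?_⟩
  · intro b' h1 h2 h3 c' l' h4 h5 h6
    have e := go b' (by omega) (by omega) (by omega)
    have := last_a b' h1 h2 (by omega)
    have : f b' ≠ f b := fun h => h2.ne (hf h)
    by_cases hb : c' = b
    · rw [hb]; omega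
    by_cases hc : c' = c
    · rw [hc]; omega
    have e' := go c' (by omega) hb hc
    have el : f l' = g l' := by
      by_cases hlb : l' = b
      · subst hlb; omega
      by_cases hlc : l' = c
      · subst hlc; omega
      exact (go l' (by omega) hlb hlc).symm
    by_contra! hlt
    have := H.1 a b' c' l' ⟨h1, h4, h5, by omega, by omega, by omega⟩
    omega
  · intro c' h1 h2
    have e := go c' (by omega) (by omega) (by omega)
    by_contra! hlt
    have := last_b c' h1 h2 (by omega) a (by omega) fac
    omega

theorem Canonical321.unique (hf : Function.Injective f) {a' b' c' : Fin n}
    (h : Canonical321 f r a b c) (h' : Canonical321 f r a' b' c') : a = a' ∧ b = b' ∧ c = c' := by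
  obtain ⟨top, ab, bc, fcb, fba, ⟨L, cL, rL⟩, first_b, first_c⟩ := h
  obtain ⟨top', ab', bc', fcb', fba', ⟨L', cL', rL'⟩, first_b', first_c'⟩ := h'
  obtain rfl : a = a' := hf (top.trans top'.symm)
  obtain rfl : b = b' := by
    rcases lt_trichotomy b b' with h | h | h
    · have := first_b' b ab h fba c L bc cL rL; omega
    · exact h
    · have := first_b b' ab' h fba' c' L' bc' cL' rL'; omega
  refine ⟨rfl, rfl, ?_⟩
  rcases lt_trichotomy c c' with h | h | h
  · have := first_c' c bc h; omega
  · exact h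
  · have := first_c c' bc' h; omega

theorem Canonical213.unique (hf : Function.Injective f) {a' b' c' : Fin n}
    (h : Canonical213 f r a b c) (h' : Canonical213 f r a' b' c') : a = a' ∧ b = b' ∧ c = c' := by
  obtain ⟨top, ab, bc, fba, fac, -, last_b, last_a⟩ := h
  obtain ⟨top', ab', bc', fba', fac', -, last_b', last_a'⟩ := h'
  obtain rfl : c = c' := hf (top.trans top'.symm)
  obtain rfl : b = b' := by
    rcases lt_trichotomy b b' with h | h | h
    · have := last_b b' h bc' (by omega) a' ab' fac'; omega
    · exact h
    · have := last_b' b h bc (by omega) a ab fac; omega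
  refine ⟨?_, rfl, rfl⟩
  rcases lt_trichotomy a a' with h | h | h
  · have := last_a a' h ab' fac'; omega
  · exact h
  · have := last_a' a h ab fac; omega

theorem exists_first {P : Fin n → Prop} (h : ∃ x, P x) : ∃ x, P x ∧ ∀ y, P y → x ≤ y := by
  classical
  obtain ⟨x, hx, hmin⟩ := Finset.exists_min_image (Finset.univ.filter P) id
    (by simpa [Finset.Nonempty] using h)
  exact ⟨x, by simpa using hx, fun y hy => hmin y (by simpa using hy)⟩

theorem exists_last {P : Fin n → Prop} (h : ∃ x, P x) : ∃ x, P x ∧ ∀ y, P y → y ≤ x := by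
  classical
  obtain ⟨x, hx, hmax⟩ := Finset.exists_max_image (Finset.univ.filter P) id
    (by simpa [Finset.Nonempty] using h)
  exact ⟨x, by simpa using hx, fun y hy => hmax y (by simpa using hy)⟩

theorem exists_canonical321 (h : ∃ i j k l, Occ3214 f i j k l ∧ f i = r) :
    ∃ a b c, Canonical321 f r a b c := by
  obtain ⟨a, j, k, l, ⟨aj, jk, kl, fkj, fja, fal⟩, rfl⟩ := h
  -- Greedy choice: the leftmost usable 2, then the leftmost smaller entry after it. The latter is
  -- no further right than `c₀`, so `l₀` still serves as the 4.
  obtain ⟨b, ⟨ab, fb, c₀, l₀, h1, h2, h3, h4⟩, hb⟩ := exists_first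
    (P := fun b => a < b ∧ f b < f a ∧ ∃ c' l', b < c' ∧ c' < l' ∧ f a < f l' ∧ f c' < f b)
    ⟨j, aj, fja, k, l, jk, kl, fal, fkj⟩
  obtain ⟨c, ⟨bc, fcb⟩, hc⟩ := exists_first (P := fun c => b < c ∧ f c < f b) ⟨c₀, h1, h4⟩
  refine ⟨a, b, c, rfl, ab, bc, fcb, fb, ⟨l₀, (hc c₀ ⟨h1, h4⟩).trans_lt h2, h3⟩, ?_, ?_⟩
  · intro b' h5 h6 h7 c' l' h8 h9 h10
    by_contra! hlt
    exact h6.not_ge (hb b' ⟨h5, h7, c', l', h8, h9, h10, hlt⟩)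
  · intro c' h5 h6
    by_contra! hlt
    exact h6.not_ge (hc c' ⟨h5, hlt⟩)

theorem exists_canonical213 (h : ∃ i j k l, Occ2134 f i j k l ∧ f k = r) :
    ∃ a b c, Canonical213 f r a b c := by
  obtain ⟨i, j, c, l, ⟨ij, jc, cl, fji, fic, fcl⟩, rfl⟩ := h
  obtain ⟨b, ⟨bc, a₀, h1, h2, h3⟩, hb⟩ := exists_last
    (P := fun b => b < c ∧ ∃ a', a' < b ∧ f a' < f c ∧ f b < f a') ⟨j, jc, i, ij, fic, fji⟩
  obtain ⟨a, ⟨ab, fac, fba⟩, ha⟩ := exists_last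
    (P := fun a => a < b ∧ f a < f c ∧ f b < f a) ⟨a₀, h1, h2, h3⟩
  refine ⟨a, b, c, rfl, ab, bc, fba, fac, ⟨l, cl, fcl⟩, ?_, ?_⟩
  · intro b' h5 h6 h7 a' h8 h9
    by_contra! hlt
    exact h5.not_ge (hb b' ⟨h6, a', h8, h9, hlt⟩)
  · intro a' h5 h6 h7
    by_contra! hlt
    exact h5.not_ge (ha a' ⟨h6, h7, hlt⟩)

theorem Canonical321.exists_occ (h : Canonical321 f r a b c) :
    ∃ i j k l, Occ3214 f i j k l ∧ f i = r := by
  obtain ⟨L, cL, rL⟩ := h.large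
  exact ⟨a, b, c, L, ⟨h.ab, h.bc, cL, h.fcb, h.top.symm ▸ h.fba, h.top.symm ▸ rL⟩, h.top⟩

theorem Canonical213.exists_occ (h : Canonical213 f r a b c) :
    ∃ i j k l, Occ2134 f i j k l ∧ f k = r := by
  obtain ⟨L, cL, rL⟩ := h.large
  exact ⟨a, b, c, L, ⟨h.ab, h.bc, cL, h.fba, h.top.symm ▸ h.fac, h.top.symm ▸ rL⟩, h.top⟩

end Rotation

open Equiv

/-! ### The sign-preserving bijection and the moving threshold -/

section Counting

variable {n : ℕ}

/-- The 3-cycle `a ↦ b ↦ c ↦ a`. -/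
def rotation (a b c : Fin n) : Perm (Fin n) := swap a b * swap b c

theorem rotation_fst {a b c : Fin n} (ab : a < b) (bc : b < c) : rotation a b c a = b := by
  rw [rotation, Perm.mul_apply, swap_apply_of_ne_of_ne ab.ne (ab.trans bc).ne, swap_apply_left]

theorem rotation_snd {a b c : Fin n} (ab : a < b) (bc : b < c) : rotation a b c b = c := by
  rw [rotation, Perm.mul_apply, swap_apply_left, swap_apply_of_ne_of_ne (ab.trans bc).ne' bc.ne']

theorem rotation_thd (a b c : Fin n) : rotation a b c c = a := by
  rw [rotation, Perm.mul_apply, swap_apply_right, swap_apply_right]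

theorem rotation_of_ne {a b c x : Fin n} (ha : x ≠ a) (hb : x ≠ b) (hc : x ≠ c) :
    rotation a b c x = x := by
  rw [rotation, Perm.mul_apply, swap_apply_of_ne_of_ne hb hc, swap_apply_of_ne_of_ne ha hb]

theorem sign_rotation {a b c : Fin n} (ab : a < b) (bc : b < c) :
    Perm.sign (rotation a b c) = 1 := by
  rw [rotation, Perm.sign_mul, Perm.sign_swap ab.ne, Perm.sign_swap bc.ne]; rfl

/-- The permutations of sign `ε` such that a `3` in a pattern `3214` is at least `m`, and a `3` in
a pattern `2134` is less than `m`. -/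
def hybridPerms (n : ℕ) (ε : ℤˣ) (m : ℕ) : Set (Perm (Fin n)) :=
  {π | Perm.sign π = ε ∧ (∀ i j k l, Occ3214 π i j k l → m ≤ π i) ∧
    ∀ i j k l, Occ2134 π i j k l → π k < m}

/-- The image of a rotation has its canonical 213 at the very positions of the canonical 321. By
uniqueness the image determines the rotation, which can therefore be undone. -/
theorem ncard_rotate (ε : ℤˣ) (r : Fin n) :
    {π : Perm (Fin n) | (Perm.sign π = ε ∧ Hybrid π r) ∧
      ∃ i j k l, Occ3214 π i j k l ∧ π i = r}.ncard =
    {π : Perm (Fin n) | (Perm.sign π = ε ∧ Hybrid π r) ∧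
      ∃ i j k l, Occ2134 π i j k l ∧ π k = r}.ncard := by
  -- `choose!` needs default positions for permutations having no such 3214.
  have : Nonempty (Fin n) := ⟨r⟩
  choose! a b c hcan using fun (π : Perm (Fin n)) (h : ∃ i j k l, Occ3214 π i j k l ∧ π i = r) =>
    exists_canonical321 h
  have forward : ∀ (π : Perm (Fin n)) (a b c : Fin n), Canonical321 π r a b c → Hybrid π r →
      Hybrid (π * rotation a b c) r ∧ Canonical213 (π * rotation a b c) r a b c := by
    intro π a b c h H
    have ga : (π * rotation a b c) a = π b := congrArg π (rotation_fst h.ab h.bc)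
    have gb : (π * rotation a b c) b = π c := congrArg π (rotation_snd h.ab h.bc)
    have gc : (π * rotation a b c) c = π a := congrArg π (rotation_thd a b c)
    have go : ∀ x, x ≠ a → x ≠ b → x ≠ c → (π * rotation a b c) x = π x :=
      fun x ha hb hc => congrArg π (rotation_of_ne ha hb hc)
    exact ⟨h.hybrid π.injective H ga gb gc go, h.canonical213 H ga gb gc go⟩
  have backward : ∀ (π : Perm (Fin n)) (a b c : Fin n), Canonical213 π r a b c → Hybrid π r →
      Hybrid (π * (rotation a b c)⁻¹) r ∧ Canonical321 (π * (rotation a b c)⁻¹) r a b c := by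
    intro π a b c h H
    have ga : (π * (rotation a b c)⁻¹) a = π c :=
      congrArg π (Perm.inv_eq_iff_eq.2 (rotation_thd a b c).symm)
    have gb : (π * (rotation a b c)⁻¹) b = π a :=
      congrArg π (Perm.inv_eq_iff_eq.2 (rotation_fst h.ab h.bc).symm)
    have gc : (π * (rotation a b c)⁻¹) c = π b :=
      congrArg π (Perm.inv_eq_iff_eq.2 (rotation_snd h.ab h.bc).symm)
    have go : ∀ x, x ≠ a → x ≠ b → x ≠ c → (π * (rotation a b c)⁻¹) x = π x :=
      fun x ha hb hc => congrArg π (Perm.inv_eq_iff_eq.2 (rotation_of_ne ha hb hc).symm)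
    exact ⟨h.hybrid π.injective H ga gb gc go, h.canonical321 π.injective H ga gb gc go⟩
  refine Set.ncard_congr (fun π _ => π * rotation (a π) (b π) (c π)) ?_ ?_ ?_
  · rintro π ⟨⟨hs, H⟩, ho⟩
    have h := hcan π ho
    obtain ⟨H', h'⟩ := forward π _ _ _ h H
    exact ⟨⟨by rw [Perm.sign_mul, sign_rotation h.ab h.bc, mul_one, hs], H'⟩, h'.exists_occ⟩
  · rintro π τ ⟨⟨-, H⟩, ho⟩ ⟨⟨-, H'⟩, ho'⟩ e
    have h := (forward π _ _ _ (hcan π ho) H).2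
    have h' := (forward τ _ _ _ (hcan τ ho') H').2
    rw [← e] at h'
    obtain ⟨ea, eb, ec⟩ := h.unique (π * _).injective h'
    rw [ea, eb, ec] at e
    exact mul_right_cancel e
  · rintro τ ⟨⟨hs, H⟩, ho⟩
    obtain ⟨x, y, z, h⟩ := exists_canonical213 ho
    obtain ⟨H', h'⟩ := backward τ x y z h H
    refine ⟨τ * (rotation x y z)⁻¹, ⟨⟨?_, H'⟩, h'.exists_occ⟩, ?_⟩
    · rw [Perm.sign_mul, Perm.sign_inv, sign_rotation h.ab h.bc, mul_one, hs]
    · obtain ⟨ea, eb, ec⟩ := (hcan _ h'.exists_occ).unique (τ * _).injective h'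
      simp only [ea, eb, ec, inv_mul_cancel_right]

/-- Both sets are complements in the common set `X`, where a 3 equal to `r` is allowed for both
patterns. The removed parts are equinumerous by `ncard_rotate`. -/
theorem ncard_hybridPerms_succ (ε : ℤˣ) (r : Fin n) :
    (hybridPerms n ε r).ncard = (hybridPerms n ε (r + 1)).ncard := by
  have h := ncard_rotate ε r
  set X := {π : Perm (Fin n) | Perm.sign π = ε ∧ Hybrid π r} with hX
  set A := {π : Perm (Fin n) | (Perm.sign π = ε ∧ Hybrid π r) ∧
      ∃ i j k l, Occ3214 π i j k l ∧ π i = r} with hA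
  set B := {π : Perm (Fin n) | (Perm.sign π = ε ∧ Hybrid π r) ∧
      ∃ i j k l, Occ2134 π i j k l ∧ π k = r} with hB
  have h1 : hybridPerms n ε r = X \ B := by
    ext π
    constructor
    · rintro ⟨hs, hJ, hF⟩
      refine ⟨⟨hs, fun i j k l h => hJ i j k l h, fun i j k l h => (hF i j k l h).le⟩, ?_⟩
      rintro ⟨-, i, j, k, l, h, e⟩
      exact (hF i j k l h).ne (congrArg Fin.val e)
    · rintro ⟨⟨hs, hJ, hF⟩, hn⟩
      refine ⟨hs, fun i j k l h => hJ i j k l h, fun i j k l h => ?_⟩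
      exact (hF i j k l h).lt_of_ne fun e => hn ⟨⟨hs, hJ, hF⟩, i, j, k, l, h, e⟩
  have h2 : hybridPerms n ε (r + 1) = X \ A := by
    ext π
    constructor
    · rintro ⟨hs, hJ, hF⟩
      refine ⟨⟨hs, fun i j k l h => (Nat.lt_of_succ_le (hJ i j k l h)).le,
        fun i j k l h => Nat.le_of_lt_succ (hF i j k l h)⟩, ?_⟩
      rintro ⟨-, i, j, k, l, h, e⟩
      exact (Nat.lt_of_succ_le (hJ i j k l h)).ne' (congrArg Fin.val e)
    · rintro ⟨⟨hs, hJ, hF⟩, hn⟩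
      refine ⟨hs, fun i j k l h => Nat.succ_le_of_lt ?_,
        fun i j k l h => Nat.lt_succ_of_le (hF i j k l h)⟩
      exact (hJ i j k l h).lt_of_ne fun e => hn ⟨⟨hs, hJ, hF⟩, i, j, k, l, h, e.symm⟩
  rw [h1, h2, Set.ncard_sdiff (fun π h => h.1), Set.ncard_sdiff (fun π h => h.1), h]

/-- For each sign, as many permutations avoid `2134` as avoid `3214`. -/
theorem ncard_avoid_2134_eq_3214 (n : ℕ) (ε : ℤˣ) :
    {π : Perm (Fin n) | Perm.sign π = ε ∧ ∀ i j k l, ¬ Occ2134 π i j k l}.ncard =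
    {π : Perm (Fin n) | Perm.sign π = ε ∧ ∀ i j k l, ¬ Occ3214 π i j k l}.ncard := by
  have h : ∀ m ≤ n, (hybridPerms n ε 0).ncard = (hybridPerms n ε m).ncard := by
    intro m
    induction m with
    | zero => exact fun _ => rfl
    | succ m ih => exact fun hm => (ih (by omega)).trans (ncard_hybridPerms_succ ε ⟨m, hm⟩)
  convert h n le_rfl using 2
  · ext π
    simp [hybridPerms]
  · ext π
    simp [hybridPerms, (Fin.is_lt _).not_ge]

end Counting

/-! ### A verified enumeration of avoiders by first entry -/

section Enumeration

/-- The values `x, y, z, t` are in the same relative order as the entries of `σ`. -/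
def SameOrder (σ : Perm (Fin 4)) (x y z t : ℕ) : Prop :=
  ((σ 1 ≤ σ 0 ↔ y ≤ x) ∧ (σ 2 ≤ σ 0 ↔ z ≤ x) ∧ (σ 2 ≤ σ 1 ↔ z ≤ y)) ∧
    (σ 3 ≤ σ 0 ↔ t ≤ x) ∧ (σ 3 ≤ σ 1 ↔ t ≤ y) ∧ (σ 3 ≤ σ 2 ↔ t ≤ z)

theorem contains_iff {n : ℕ} (σ : Perm (Fin 4)) (π : Perm (Fin n)) :
    Contains σ π ↔ ∃ i j k l, i < j ∧ j < k ∧ k < l ∧ SameOrder σ (π i) (π j) (π k) (π l) := by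
  constructor
  · rintro ⟨f, hf, h⟩
    have h' : ∀ i j, σ i ≤ σ j ↔ (π (f i) : ℕ) ≤ π (f j) := fun i j => by
      rw [← not_lt, ← h, not_lt, Fin.le_def]
    exact ⟨f 0, f 1, f 2, f 3, hf (by decide), hf (by decide), hf (by decide),
      ⟨h' _ _, h' _ _, h' _ _⟩, h' _ _, h' _ _, h' _ _⟩
  · rintro ⟨i, j, k, l, ij, jk, kl, h⟩
    have hmono : StrictMono ![i, j, k, l] := by
      refine Fin.strictMono_iff_lt_succ.2 fun x => ?_
      fin_cases x <;> assumption
    refine ⟨_, hmono, ?_⟩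
    have le : ∀ x y : Fin 4, x < y → (σ y ≤ σ x ↔ π (![i, j, k, l] y) ≤ π (![i, j, k, l] x)) := by
      obtain ⟨⟨h1, h2, h3⟩, h4, h5, h6⟩ := h
      intro x y hxy
      fin_cases x <;> fin_cases y <;>
        first
          | exact absurd hxy (by decide)
          | assumption
    intro x y
    rcases lt_trichotomy x y with h | h | h
    · rw [← not_le, ← le x y h, not_le]
    · simp [h]
    · rw [lt_iff_le_and_ne, lt_iff_le_and_ne, ← le y x h]
      simp [h.ne', hmono.injective.eq_iff]

/-- The word of a permutation. -/
def word {n : ℕ} (π : Perm (Fin n)) : List ℕ := List.ofFn fun i => (π i : ℕ)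

/-- Makes room for the value `a`. -/
def bump (a x : ℕ) : ℕ := bif Nat.ble a x then x + 1 else x

/-- Whether some subword of `w` extends the partial match `P` of entries of a pattern with values
to a match of the remaining entries of the pattern. -/
def matchFrom : List (ℕ × ℕ) → List ℕ → List ℕ → Bool
  | _, [], _ => true
  | _, _ :: _, [] => false
  | P, s :: S, x :: w =>
    (P.all (fun q => bif Nat.ble s q.1 then Nat.ble x q.2 else !Nat.ble x q.2)
      && matchFrom ((s, x) :: P) S w) ||
      matchFrom P (s :: S) w

/-- The words of the permutations of length `n` that avoid the pattern with first entry `s` and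
remaining entries `S`, each with the information whether the permutation is even. -/
def avoidingWords (s : ℕ) (S : List ℕ) : ℕ → List (Bool × List ℕ)
  | 0 => [(true, [])]
  | n + 1 => (avoidingWords s S n).flatMap fun p =>
      ((List.range (n + 1)).filter (fun a => !matchFrom [(s, a)] S (p.2.map (bump a)))).map
        fun a => (xor p.1 (Nat.bodd a), a :: p.2.map (bump a))

def countEven (s : ℕ) (S : List ℕ) (n : ℕ) : ℕ :=
  ((avoidingWords s S n).map fun p => p.1.toNat).sum

/-- Turns the backtracking into an existential over the next matched position. Stated for suffixes,
it applies again to the suffix after that position. -/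
theorem matchFrom_drop {n : ℕ} (f : Fin n → ℕ) (P : List (ℕ × ℕ)) (s : ℕ) (S : List ℕ) (d : ℕ) :
    matchFrom P (s :: S) ((List.ofFn f).drop d) = true ↔
      ∃ k : Fin n, d ≤ k ∧ (∀ q ∈ P, s ≤ q.1 ↔ f k ≤ q.2) ∧
        matchFrom ((s, f k) :: P) S ((List.ofFn f).drop (k + 1)) = true := by
  induction h : n - d generalizing d with
  | zero =>
    rw [List.drop_of_length_le (by simp; omega)]
    simp only [matchFrom, Bool.false_eq_true, false_iff, not_exists]
    rintro k ⟨hk, -⟩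
    omega
  | succ e ih =>
    have hd : d < n := by omega
    rw [List.drop_eq_getElem_cons (by simpa using hd), matchFrom, Bool.or_eq_true, Bool.and_eq_true,
      ih (d + 1) (by omega), List.getElem_ofFn]
    have hP : ∀ x, (P.all (fun q => bif Nat.ble s q.1 then Nat.ble x q.2 else !Nat.ble x q.2)) = true
        ↔ ∀ q ∈ P, s ≤ q.1 ↔ x ≤ q.2 := by
      intro x
      rw [List.all_eq_true]
      refine forall₂_congr fun q _ => ?_
      rcases h1 : Nat.ble s q.1 with _ | _ <;> rcases h2 : Nat.ble x q.2 with _ | _ <;>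
        simp_all [← Nat.ble_eq]
    rw [hP]
    constructor
    · rintro (h | ⟨k, hk, h⟩)
      · exact ⟨⟨d, hd⟩, le_rfl, h⟩
      · exact ⟨k, by omega, h⟩
    · rintro ⟨k, hk, hm⟩
      rcases hk.eq_or_lt with rfl | hk
      · exact .inl hm
      · exact .inr ⟨k, hk, hm⟩

theorem matchFrom_word {n : ℕ} (σ : Perm (Fin 4)) (x : ℕ) (f : Fin n → ℕ) :
    matchFrom [((σ 0 : ℕ), x)] [(σ 1 : ℕ), (σ 2 : ℕ), (σ 3 : ℕ)] (List.ofFn f) = true ↔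
      ∃ j k l, j < k ∧ k < l ∧ SameOrder σ x (f j) (f k) (f l) := by
  rw [← List.drop_zero (l := List.ofFn f), matchFrom_drop]
  simp only [matchFrom_drop, matchFrom, List.forall_mem_cons, SameOrder, Fin.le_def]
  constructor
  · rintro ⟨j, -, ⟨h1, -⟩, k, hk, ⟨h2, h3, -⟩, l, hl, ⟨h4, h5, h6, -⟩, -⟩
    exact ⟨j, k, l, hk, hl, ⟨h1, h3, h2⟩, h6, h5, h4⟩
  · rintro ⟨j, k, l, hk, hl, ⟨h1, h3, h2⟩, h6, h5, h4⟩
    exact ⟨j, Nat.zero_le _, ⟨h1, by simp⟩, k, hk, ⟨h2, h3, by simp⟩, l, hl,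
      ⟨h4, h5, h6, by simp⟩, trivial⟩

/-- The permutation with first entry `a` whose remaining entries are order-isomorphic to `ρ`. -/
def consPerm {n : ℕ} (a : Fin (n + 1)) (ρ : Perm (Fin n)) : Perm (Fin (n + 1)) :=
  a.cycleRange⁻¹ * Perm.decomposeFin.symm (0, ρ)

variable {n : ℕ} (a : Fin (n + 1)) (ρ : Perm (Fin n))

theorem consPerm_zero : consPerm a ρ 0 = a := by
  simp [consPerm, Perm.inv_def]

theorem consPerm_succ (i : Fin n) : consPerm a ρ i.succ = a.succAbove (ρ i) := by
  simp [consPerm, Perm.inv_def]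

/-- The first entry `a` contributes exactly `a` inversions. -/
theorem sign_consPerm : Perm.sign (consPerm a ρ) = (-1) ^ (a : ℕ) * Perm.sign ρ := by
  simp [consPerm, Fin.sign_cycleRange]

theorem bijective_consPerm :
    Function.Bijective fun p : Fin (n + 1) × Perm (Fin n) => consPerm p.1 p.2 := by
  rw [Fintype.bijective_iff_injective_and_card]
  refine ⟨?_, ?_⟩
  · rintro ⟨a, ρ⟩ ⟨b, τ⟩ h
    dsimp only at h
    obtain rfl : a = b := by rw [← consPerm_zero a ρ, h, consPerm_zero]
    refine Prod.ext rfl (Equiv.ext fun i => ?_)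
    have := congrArg (fun π : Perm (Fin (n + 1)) => π i.succ) h
    simpa [consPerm_succ] using this
  · simp [Fintype.card_perm, Nat.factorial_succ]

theorem val_succAbove (x : Fin n) : (a.succAbove x : ℕ) = bump a x := by
  rw [bump, Fin.succAbove]
  rcases h : Nat.ble a x with _ | _
  · have : ¬ (a : ℕ) ≤ x := by rw [← Nat.ble_eq, h]; simp
    rw [if_pos (by rw [Fin.lt_def]; simp; omega)]
    simp
  · have : (a : ℕ) ≤ x := Nat.le_of_ble_eq_true h
    rw [if_neg (by rw [Fin.lt_def]; simp; omega)]
    simp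

theorem word_consPerm : word (consPerm a ρ) = (a : ℕ) :: (word ρ).map (bump a) := by
  simp [word, List.ofFn_succ, consPerm_zero, consPerm_succ, val_succAbove, List.map_ofFn,
    Function.comp_def]

/-- Only the first index of an occurrence can be position 0. Occurrences that miss it live in `ρ`,
so extending an avoider requires testing only matches anchored at the new entry. -/
theorem contains_consPerm (σ : Perm (Fin 4)) :
    Contains σ (consPerm a ρ) ↔ Contains σ ρ ∨
      matchFrom [((σ 0 : ℕ), (a : ℕ))] [(σ 1 : ℕ), (σ 2 : ℕ), (σ 3 : ℕ)]
        ((word ρ).map (bump a)) = true := by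
  have hw : (word ρ).map (bump a) = List.ofFn fun i => (a.succAbove (ρ i) : ℕ) := by
    simp [word, val_succAbove, List.map_ofFn, Function.comp_def]
  rw [hw, matchFrom_word, contains_iff, contains_iff, or_comm]
  constructor
  · rintro ⟨i, j, k, l, ij, jk, kl, h⟩
    obtain ⟨j, rfl⟩ := Fin.exists_succ_eq.2 (Fin.ne_zero_of_lt ij)
    obtain ⟨k, rfl⟩ := Fin.exists_succ_eq.2 (Fin.ne_zero_of_lt jk)
    obtain ⟨l, rfl⟩ := Fin.exists_succ_eq.2 (Fin.ne_zero_of_lt kl)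
    rw [Fin.succ_lt_succ_iff] at jk kl
    rcases Fin.eq_zero_or_eq_succ i with rfl | ⟨i, rfl⟩
    · simp only [consPerm_zero, consPerm_succ] at h
      exact .inl ⟨j, k, l, jk, kl, h⟩
    · rw [Fin.succ_lt_succ_iff] at ij
      simp only [consPerm_succ, SameOrder, ← Fin.le_def, Fin.succAbove_le_succAbove_iff] at h
      exact .inr ⟨i, j, k, l, ij, jk, kl, h⟩
  · rintro (⟨j, k, l, jk, kl, h⟩ | ⟨i, j, k, l, ij, jk, kl, h⟩)
    · refine ⟨0, j.succ, k.succ, l.succ, Fin.succ_pos _, by simpa, by simpa, ?_⟩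
      simpa only [consPerm_zero, consPerm_succ] using h
    · refine ⟨i.succ, j.succ, k.succ, l.succ, by simpa, by simpa, by simpa, ?_⟩
      simpa only [consPerm_succ, SameOrder, ← Fin.le_def, Fin.succAbove_le_succAbove_iff] using h

theorem decide_sign_consPerm :
    decide (Perm.sign (consPerm a ρ) = 1) = xor (decide (Perm.sign ρ = 1)) (Nat.bodd a) := by
  rw [sign_consPerm, pow_eq_pow_mod (a : ℕ) (neg_one_sq : (-1 : ℤˣ) ^ 2 = 1), Nat.mod_two_of_bodd]
  rcases Int.units_eq_one_or (Perm.sign ρ) with h | h <;>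
    rcases Nat.bodd a with _ | _ <;> rw [h] <;> rfl

theorem sum_map_filter {α : Type*} (p : α → Bool) (g : α → ℕ) (l : List α) :
    ((l.filter p).map g).sum = (l.map fun x => if p x then g x else 0).sum := by
  induction l with
  | nil => rfl
  | cons x l ih => by_cases h : p x <;> simp [h, ih]

-- An arbitrary weight `G` is needed for the induction: the step applies the hypothesis to the
-- weight that sums `G` over all admissible extensions of a word.
open Classical in
theorem sum_avoidingWords (σ : Perm (Fin 4)) (n : ℕ) (G : Bool × List ℕ → ℕ) :
    (∑ π : Perm (Fin n), if Contains σ π then 0 else G (decide (Perm.sign π = 1), word π)) =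
      ((avoidingWords (σ 0) [(σ 1 : ℕ), (σ 2 : ℕ), (σ 3 : ℕ)] n).map G).sum := by
  induction n generalizing G with
  | zero =>
    have : ∀ π : Perm (Fin 0), ¬ Contains σ π := fun π ⟨f, _⟩ => (f 0).elim0
    simp [this, avoidingWords, word]
  | succ n ih =>
    rw [← bijective_consPerm.sum_comp, Fintype.sum_prod_type_right, avoidingWords,
      List.map_flatMap, List.flatMap_def, List.sum_flatten, List.map_map, Function.comp_def, ← ih]
    refine Finset.sum_congr rfl fun ρ _ => ?_
    by_cases hρ : Contains σ ρ
    · simp [contains_consPerm, hρ]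
    · simp only [contains_consPerm, hρ, false_or, if_false, decide_sign_consPerm, word_consPerm,
        List.map_map, Function.comp_def, sum_map_filter]
      rw [Fin.sum_univ_eq_sum_range (fun a => if matchFrom [((σ 0 : ℕ), a)]
        [(σ 1 : ℕ), (σ 2 : ℕ), (σ 3 : ℕ)] ((word ρ).map (bump a)) = true then 0 else
        G (xor (decide (Perm.sign ρ = 1)) (Nat.bodd a), a :: (word ρ).map (bump a))) (n + 1)]
      change (List.map _ (List.range (n + 1))).sum = _
      congr 2
      funext a
      cases matchFrom [((σ 0 : ℕ), a)] [(σ 1 : ℕ), (σ 2 : ℕ), (σ 3 : ℕ)]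
        ((word ρ).map (bump a)) <;> rfl

theorem evenAv_eq_countEven (σ : Perm (Fin 4)) (n : ℕ) :
    evenAv n σ = countEven (σ 0) [(σ 1 : ℕ), (σ 2 : ℕ), (σ 3 : ℕ)] n := by
  classical
  have h : (evenAvoiders n σ).toFinset =
      Finset.univ.filter fun π => Perm.sign π = 1 ∧ ¬ Contains σ π := by
    ext
    rw [Set.mem_toFinset]
    simp [evenAvoiders]
  rw [countEven, ← sum_avoidingWords, evenAv, Set.ncard_eq_toFinset_card', h, Finset.card_filter]
  refine Finset.sum_congr rfl fun π _ => ?_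
  by_cases h1 : Perm.sign π = 1 <;> by_cases h2 : Contains σ π <;> simp [h1, h2]

end Enumeration

/-! ### Symmetries of containment and their effect on sign -/

section Symmetry

variable {k n : ℕ}

theorem Contains.inv {σ : Perm (Fin k)} {π : Perm (Fin n)} (h : Contains σ π) :
    Contains σ⁻¹ π⁻¹ := by
  obtain ⟨f, hf, h⟩ := h
  refine ⟨fun i => π (f (σ⁻¹ i)), fun i j hij => ?_, fun i j => ?_⟩
  · simpa [h] using hij
  · simp [hf.lt_iff_lt]

theorem Contains.reverse {σ : Perm (Fin k)} {π : Perm (Fin n)} (h : Contains σ π) :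
    Contains (reverse σ) (reverse π) := by
  obtain ⟨f, hf, h⟩ := h
  refine ⟨fun i => (f i.rev).rev, fun i j hij => ?_, fun i j => ?_⟩
  · simpa using hf (Fin.rev_lt_rev.2 hij)
  · simp [EvenWilf.reverse, h]

theorem Contains.complement {σ : Perm (Fin k)} {π : Perm (Fin n)} (h : Contains σ π) :
    Contains (complement σ) (complement π) := by
  obtain ⟨f, hf, h⟩ := h
  refine ⟨f, hf, fun i j => ?_⟩
  simp [EvenWilf.complement, h]

theorem reverse_reverse (σ : Perm (Fin k)) : reverse (reverse σ) = σ := by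
  ext i; simp [reverse]

theorem complement_complement (σ : Perm (Fin k)) : complement (complement σ) = σ := by
  ext i; simp [complement]

theorem complement_reverse (σ : Perm (Fin k)) : complement (reverse σ) = reverse (complement σ) :=
  rfl

theorem contains_reverse_iff {σ : Perm (Fin k)} {π : Perm (Fin n)} :
    Contains (reverse σ) (reverse π) ↔ Contains σ π :=
  ⟨fun h => by simpa [reverse_reverse] using h.reverse, Contains.reverse⟩

theorem sign_reverse (π : Perm (Fin n)) :
    Perm.sign (reverse π) = Perm.sign π * Perm.sign (Fin.revPerm : Perm (Fin n)) := by
  rw [← Perm.sign_mul]; rfl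

theorem sign_complement (π : Perm (Fin n)) :
    Perm.sign (complement π) = Perm.sign (Fin.revPerm : Perm (Fin n)) * Perm.sign π := by
  rw [← Perm.sign_mul]; rfl

theorem sign_complement_reverse (π : Perm (Fin n)) :
    Perm.sign (complement (reverse π)) = Perm.sign π := by
  rw [sign_complement, sign_reverse, mul_left_comm, Int.units_mul_self, mul_one]

theorem evenWilf_inv (σ : Perm (Fin k)) : evenWilf k σ⁻¹ σ := by
  intro n
  refine Set.ncard_congr (fun π _ => π⁻¹) ?_ (fun _ _ _ _ h => inv_injective h) ?_
  · rintro π ⟨h1, h2⟩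
    exact ⟨by rwa [Perm.sign_inv], fun h => h2 (by simpa using h.inv)⟩
  · rintro π ⟨h1, h2⟩
    exact ⟨π⁻¹, ⟨by rwa [Perm.sign_inv], fun h => h2 (by simpa using h.inv)⟩, inv_inv π⟩

theorem evenWilf_complement_reverse (σ : Perm (Fin k)) :
    evenWilf k (complement (reverse σ)) σ := by
  have inv {n : ℕ} (π : Perm (Fin n)) : complement (reverse (complement (reverse π))) = π := by
    rw [← complement_reverse, reverse_reverse, complement_complement]
  intro n
  refine Set.ncard_congr (fun π _ => complement (reverse π)) ?_
    (fun π τ _ _ h => by rw [← inv π, h, inv]) ?_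
  · rintro π ⟨h1, h2⟩
    exact ⟨by rwa [sign_complement_reverse],
      fun h => h2 (by simpa only [inv] using h.reverse.complement)⟩
  · rintro π ⟨h1, h2⟩
    exact ⟨complement (reverse π), ⟨by rwa [sign_complement_reverse],
      fun h => h2 (by simpa only [inv] using h.reverse.complement)⟩, inv π⟩

theorem evenWilf_of_mem_trivialClass {σ τ : Perm (Fin k)} (h : σ ∈ trivialClass τ) :
    evenWilf k σ τ := by
  rcases h with rfl | rfl | rfl | rfl
  · exact (evenWilf k).refl _
  · exact evenWilf_inv τ
  · exact evenWilf_complement_reverse τ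
  · exact (evenWilf k).trans (evenWilf_complement_reverse τ⁻¹) (evenWilf_inv τ)

/-- Reversal alone may change parity, but by a factor depending only on `n`. This is why the
bijection is needed for both signs. -/
theorem evenAv_reverse (σ : Perm (Fin k)) (n : ℕ) :
    evenAv n (reverse σ) = {π : Perm (Fin n) |
      Perm.sign π = Perm.sign (Fin.revPerm : Perm (Fin n)) ∧ ¬ Contains σ π}.ncard := by
  refine Set.ncard_congr (fun π _ => reverse π) ?_
    (fun π τ _ _ h => by rw [← reverse_reverse π, h, reverse_reverse]) ?_
  · rintro π ⟨h1, h2⟩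
    refine ⟨by rw [sign_reverse, h1, one_mul], fun h => h2 ?_⟩
    simpa only [reverse_reverse] using h.reverse
  · rintro π ⟨h1, h2⟩
    exact ⟨reverse π, ⟨by rw [sign_reverse, h1, Int.units_mul_self],
      fun h => h2 (contains_reverse_iff.1 h)⟩, reverse_reverse π⟩

theorem contains_3214_iff (π : Perm (Fin n)) :
    Contains (swap (0 : Fin 4) 2) π ↔ ∃ i j k l, Occ3214 π i j k l := by
  have h0 : swap (0 : Fin 4) 2 0 = 2 := by decide
  have h1 : swap (0 : Fin 4) 2 1 = 1 := by decide
  have h2 : swap (0 : Fin 4) 2 2 = 0 := by decide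
  have h3 : swap (0 : Fin 4) 2 3 = 3 := by decide
  rw [contains_iff]
  refine exists_congr fun i => exists_congr fun j => exists_congr fun k => exists_congr fun l =>
    and_congr_right fun ij => and_congr_right fun jk => and_congr_right fun kl => ?_
  -- `SameOrder` compares weakly; distinctness of the entries supplies the strict inequalities.
  have hij := π.injective.ne ij.ne
  have hjk := π.injective.ne jk.ne
  have hik := π.injective.ne (ij.trans jk).ne
  rw [SameOrder, h0, h1, h2, h3]
  omega

theorem contains_2134_iff (π : Perm (Fin n)) :
    Contains (swap (0 : Fin 4) 1) π ↔ ∃ i j k l, Occ2134 π i j k l := by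
  have h0 : swap (0 : Fin 4) 1 0 = 1 := by decide
  have h1 : swap (0 : Fin 4) 1 1 = 0 := by decide
  have h2 : swap (0 : Fin 4) 1 2 = 2 := by decide
  have h3 : swap (0 : Fin 4) 1 3 = 3 := by decide
  rw [contains_iff]
  refine exists_congr fun i => exists_congr fun j => exists_congr fun k => exists_congr fun l =>
    and_congr_right fun ij => and_congr_right fun jk => and_congr_right fun kl => ?_
  have hij := π.injective.ne ij.ne
  have hjk := π.injective.ne jk.ne
  have hik := π.injective.ne (ij.trans jk).ne
  rw [SameOrder, h0, h1, h2, h3]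
  omega

theorem ncard_avoid_eq (n : ℕ) (ε : ℤˣ) :
    {π : Perm (Fin n) | Perm.sign π = ε ∧ ¬ Contains (swap (0 : Fin 4) 1) π}.ncard =
    {π : Perm (Fin n) | Perm.sign π = ε ∧ ¬ Contains (swap (0 : Fin 4) 2) π}.ncard := by
  simpa only [contains_3214_iff, contains_2134_iff, not_exists] using ncard_avoid_2134_eq_3214 n ε

theorem evenWilf_swap : evenWilf 4 (swap 0 1) (swap 0 2) := fun n => ncard_avoid_eq n 1

theorem evenWilf_reverse_swap : evenWilf 4 (reverse (swap 0 1)) (reverse (swap 0 2)) := fun n => by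
  rw [evenAv_reverse, evenAv_reverse, ncard_avoid_eq]

end Symmetry

/-! ### The eleven classes and their separation -/

section Classes

/-- The one-line words of the patterns in the eleven classes. -/
def classWords : Fin 11 → Finset ℕ :=
  ![{3214, 1432, 2134, 1243}, {3421, 4312, 4123, 2341}, {2431, 3241, 4132, 4213},
    {1342, 1423, 2314, 3124}, {2413, 3142}, {1234}, {4321}, {2143}, {3412}, {1324}, {4231}]

/-- The trivial class of a pattern as a finset. -/
def trivialFinset (σ : Perm (Fin 4)) : Finset (Perm (Fin 4)) :=
  {σ, σ⁻¹, complement (reverse σ), complement (reverse σ⁻¹)}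

theorem coe_trivialFinset (σ : Perm (Fin 4)) : (trivialFinset σ : Set _) = trivialClass σ := by
  simp [trivialFinset, trivialClass]

theorem evenWilf_of_mem_trivialFinset {σ τ : Perm (Fin 4)} (h : σ ∈ trivialFinset τ) :
    evenWilf 4 σ τ :=
  evenWilf_of_mem_trivialClass (by rwa [← coe_trivialFinset])

theorem exists_mem_classWords : ∀ σ : Perm (Fin 4), ∃ i, oneLine σ ∈ classWords i := by
  decide +kernel

theorem exists_oneLine_mem : ∀ i, ∃ σ : Perm (Fin 4), oneLine σ ∈ classWords i := by
  decide +kernel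

/-- Nine of the lists are single trivial classes; lists 0 and 1 are each a union of two. -/
theorem mem_trivialFinset_of_mem_classWords : ∀ i, ∀ σ τ : Perm (Fin 4),
    oneLine σ ∈ classWords i → oneLine τ ∈ classWords i →
      σ ∈ trivialFinset τ ∨ i = 0 ∨ i = 1 := by
  decide +kernel

theorem mem_trivialFinset_of_mem_classWords_zero : ∀ σ : Perm (Fin 4), oneLine σ ∈ classWords 0 →
    σ ∈ trivialFinset (swap 0 1) ∨ σ ∈ trivialFinset (swap 0 2) := by
  decide +kernel

theorem mem_trivialFinset_of_mem_classWords_one : ∀ σ : Perm (Fin 4), oneLine σ ∈ classWords 1 →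
    σ ∈ trivialFinset (reverse (swap 0 1)) ∨ σ ∈ trivialFinset (reverse (swap 0 2)) := by
  decide +kernel

theorem evenWilf_of_mem_classWords {i : Fin 11} {σ τ : Perm (Fin 4)}
    (hσ : oneLine σ ∈ classWords i) (hτ : oneLine τ ∈ classWords i) : evenWilf 4 σ τ := by
  have tr {ρ ρ' : Perm (Fin 4)} (h : evenWilf 4 ρ ρ') {σ : Perm (Fin 4)}
      (hσ : σ ∈ trivialFinset ρ ∨ σ ∈ trivialFinset ρ') : evenWilf 4 σ ρ' :=
    hσ.elim (fun hσ => (evenWilf 4).trans (evenWilf_of_mem_trivialFinset hσ) h)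
      evenWilf_of_mem_trivialFinset
  rcases mem_trivialFinset_of_mem_classWords i σ τ hσ hτ with h | rfl | rfl
  · exact evenWilf_of_mem_trivialFinset h
  · exact (evenWilf 4).trans
      (tr evenWilf_swap (mem_trivialFinset_of_mem_classWords_zero σ hσ))
      ((evenWilf 4).symm (tr evenWilf_swap (mem_trivialFinset_of_mem_classWords_zero τ hτ)))
  · exact (evenWilf 4).trans
      (tr evenWilf_reverse_swap (mem_trivialFinset_of_mem_classWords_one σ hσ))
      ((evenWilf 4).symm (tr evenWilf_reverse_swap (mem_trivialFinset_of_mem_classWords_one τ hτ)))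

/-- One word from each of the eleven classes, with entries `0, …, 3`. -/
def representative : Fin 11 → List ℕ :=
  ![[2, 1, 0, 3], [3, 0, 1, 2], [1, 3, 2, 0], [0, 2, 3, 1], [1, 3, 0, 2], [0, 1, 2, 3],
    [3, 2, 1, 0], [1, 0, 3, 2], [2, 3, 0, 1], [0, 2, 1, 3], [3, 1, 2, 0]]

def evenCount (n : ℕ) (i : Fin 11) : ℕ :=
  countEven ((representative i).headD 0) (representative i).tail n

theorem exists_representative : ∀ i, ∃ σ : Perm (Fin 4), oneLine σ ∈ classWords i ∧
    [(σ 0 : ℕ), (σ 1 : ℕ), (σ 2 : ℕ), (σ 3 : ℕ)] = representative i := by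
  decide +kernel

theorem evenAv_eq_evenCount {i : Fin 11} {σ : Perm (Fin 4)} (h : oneLine σ ∈ classWords i)
    (n : ℕ) : evenAv n σ = evenCount n i := by
  obtain ⟨ρ, hρ, hw⟩ := exists_representative i
  rw [evenWilf_of_mem_classWords h hρ n, evenAv_eq_countEven, evenCount, ← hw]
  rfl

/-- At length 4 only the pattern itself is excluded, so the count records its parity: 11 if even, 12
if odd. -/
theorem evenCount_four : ∀ i, evenCount 4 i = ![12, 12, 11, 11, 12, 11, 11, 11, 11, 12, 12] i := by
  decide +kernel

theorem evenCount_six :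
    ∀ i, evenCount 6 i = ![257, 256, 255, 257, 256, 258, 255, 256, 257, 258, 255] i := by
  decide +kernel

theorem evenCount_seven_1 : evenCount 7 1 = 1380 := by decide +kernel
theorem evenCount_seven_2 : evenCount 7 2 = 1369 := by decide +kernel
theorem evenCount_seven_3 : evenCount 7 3 = 1371 := by decide +kernel
theorem evenCount_seven_4 : evenCount 7 4 = 1370 := by decide +kernel
theorem evenCount_seven_6 : evenCount 7 6 = 1379 := by decide +kernel
theorem evenCount_seven_8 : evenCount 7 8 = 1381 := by decide +kernel

/-- Lengths 4 and 6 separate all classes except the pairs 1 and 4, 2 and 6, 3 and 8, which differ at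
length 7. -/
theorem exists_evenCount_ne {i j : Fin 11} (h : i ≠ j) :
    ∃ n ≤ 10, evenCount n i ≠ evenCount n j := by
  have key : ∀ i j : Fin 11, i ≠ j →
      ![12, 12, 11, 11, 12, 11, 11, 11, 11, 12, 12] i ≠
        ![12, 12, 11, 11, 12, 11, 11, 11, 11, 12, 12] j ∨
      ![257, 256, 255, 257, 256, 258, 255, 256, 257, 258, 255] i ≠
        ![257, 256, 255, 257, 256, 258, 255, 256, 257, 258, 255] j ∨
      (i, j) ∈ [((1 : Fin 11), (4 : Fin 11)), (4, 1), (2, 6), (6, 2), (3, 8), (8, 3)] := by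
    decide +kernel
  rcases key i j h with h | h | h
  · exact ⟨4, by norm_num, by rwa [evenCount_four, evenCount_four]⟩
  · exact ⟨6, by norm_num, by rwa [evenCount_six, evenCount_six]⟩
  · refine ⟨7, by norm_num, ?_⟩
    simp only [List.mem_cons, Prod.mk.injEq, List.not_mem_nil, or_false] at h
    rcases h with ⟨rfl, rfl⟩ | ⟨rfl, rfl⟩ | ⟨rfl, rfl⟩ | ⟨rfl, rfl⟩ | ⟨rfl, rfl⟩ | ⟨rfl, rfl⟩ <;>
      simp only [evenCount_seven_1, evenCount_seven_2, evenCount_seven_3, evenCount_seven_4,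
        evenCount_seven_6, evenCount_seven_8] <;> norm_num

theorem exists_evenAv_ne {i j : Fin 11} (h : i ≠ j) {σ τ : Perm (Fin 4)}
    (hσ : oneLine σ ∈ classWords i) (hτ : oneLine τ ∈ classWords j) :
    ∃ n ≤ 10, evenAv n σ ≠ evenAv n τ := by
  simpa only [evenAv_eq_evenCount hσ, evenAv_eq_evenCount hτ] using exists_evenCount_ne h

/-- The eleven classes. -/
def patternClass (i : Fin 11) : Set (Perm (Fin 4)) := patterns (classWords i)

theorem classes_eq_range : (evenWilf 4).classes = Set.range patternClass := by
  have h : ∀ i τ, oneLine τ ∈ classWords i → patternClass i = {σ | evenWilf 4 σ τ} := by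
    intro i τ hτ
    ext σ
    refine ⟨fun hσ => evenWilf_of_mem_classWords hσ hτ, fun hσ => ?_⟩
    obtain ⟨j, hj⟩ := exists_mem_classWords σ
    by_cases hij : j = i
    · exact hij ▸ hj
    · obtain ⟨n, -, hn⟩ := exists_evenAv_ne hij hj hτ
      exact absurd (hσ n) hn
  ext C
  constructor
  · rintro ⟨τ, rfl⟩
    obtain ⟨i, hi⟩ := exists_mem_classWords τ
    exact ⟨i, h i τ hi⟩
  · rintro ⟨i, rfl⟩
    obtain ⟨τ, hτ⟩ := exists_oneLine_mem i
    exact ⟨τ, h i τ hτ⟩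

theorem patternClass_injective : Function.Injective patternClass := by
  intro i j h
  by_contra hij
  obtain ⟨σ, hσ⟩ := exists_oneLine_mem i
  have hσ' : σ ∈ patternClass j := h ▸ hσ
  obtain ⟨n, -, hn⟩ := exists_evenAv_ne hij hσ hσ'
  exact hn rfl

theorem isNontrivialClass_iff (i : Fin 11) :
    IsNontrivialClass (patternClass i) ↔ i = 0 ∨ i = 1 := by
  have key : ∀ i, (∃ σ, ∀ τ, oneLine τ ∈ classWords i ↔ τ ∈ trivialFinset σ) ↔
      ¬ (i = 0 ∨ i = 1) := by
    decide +kernel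
  rw [← not_iff_not, ← key, IsNontrivialClass, not_not]
  refine exists_congr fun σ => ?_
  rw [← coe_trivialFinset, Set.ext_iff]
  rfl

theorem reverse_image_patternClass : reverse '' patternClass 0 = patternClass 1 := by
  have key : ∀ τ, (∃ σ, oneLine σ ∈ classWords 0 ∧ reverse σ = τ) ↔ oneLine τ ∈ classWords 1 := by
    decide +kernel
  exact Set.ext key

end Classes
end EvenWilf

open EvenWilf
theorem mainTheorem3 :
    -- the complete list of the even-Wilf-equivalence classes of patterns of length 4
    (evenWilf 4).classes =
      {patterns {3214, 1432, 2134, 1243},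
       patterns {3421, 4312, 4123, 2341},
       patterns {2431, 3241, 4132, 4213},
       patterns {1342, 1423, 2314, 3124},
       patterns {2413, 3142},
       patterns {1234},
       patterns {4321},
       patterns {2143},
       patterns {3412},
       patterns {1324},
       patterns {4231}} ∧
    -- there are exactly eleven of them
    (evenWilf 4).classes.ncard = 11 ∧
    -- exactly two of them are non-trivial
    {C | C ∈ (evenWilf 4).classes ∧ IsNontrivialClass C} =
      {patterns {3214, 1432, 2134, 1243}, patterns {3421, 4312, 4123, 2341}} ∧
    -- and the second consists of the reverses of the first
    reverse '' patterns {3214, 1432, 2134, 1243} = patterns {3421, 4312, 4123, 2341} ∧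
    -- distinct classes are separated by the numbers of even avoiders of length at most 10
    (∀ σ τ : Equiv.Perm (Fin 4), ¬ (evenWilf 4) σ τ → ∃ n ≤ 10, evenAv n σ ≠ evenAv n τ) := by
  have h0 : patterns {3214, 1432, 2134, 1243} = patternClass 0 := by
    simp [patternClass, classWords]
  have h1 : patterns {3421, 4312, 4123, 2341} = patternClass 1 := by
    simp [patternClass, classWords]
  have hr : Set.range patternClass = {patternClass 0, patternClass 1, patternClass 2,
      patternClass 3, patternClass 4, patternClass 5, patternClass 6, patternClass 7,
      patternClass 8, patternClass 9, patternClass 10} := by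
    ext C
    simp [Fin.exists_fin_succ, eq_comm]
  refine ⟨?_, ?_, ?_, ?_, ?_⟩
  · rw [classes_eq_range, hr]
    simp [patternClass, classWords]
  · rw [classes_eq_range, Set.ncard_range_of_injective patternClass_injective, Nat.card_fin]
  · rw [h0, h1, classes_eq_range]
    ext C
    constructor
    · rintro ⟨⟨i, rfl⟩, h⟩
      rcases (isNontrivialClass_iff i).1 h with rfl | rfl
      · exact .inl rfl
      · exact .inr rfl
    · rintro (rfl | rfl)
      · exact ⟨⟨0, rfl⟩, (isNontrivialClass_iff 0).2 (.inl rfl)⟩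
      · exact ⟨⟨1, rfl⟩, (isNontrivialClass_iff 1).2 (.inr rfl)⟩
  · rw [h0, h1, reverse_image_patternClass]
  · intro σ τ h
    obtain ⟨i, hi⟩ := exists_mem_classWords σ
    obtain ⟨j, hj⟩ := exists_mem_classWords τ
    exact exists_evenAv_ne (fun hij : i = j => h (evenWilf_of_mem_classWords hi (hij.symm ▸ hj))) hi hj
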